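/- All graphs are finite and simple, and $\log$ is the natural logarithm. A *cover* of a graph $G$ is a pair $\mathscr{H}=(L,H)$ consisting of a graph $H$ and a mapping $L\colon V(G)\to 2^{V(H)}$ such that (i) the sets $L(u)$, $u\in V(G)$, partition $V(H)$; (ii) $H[L(u)]$ is complete for every $u\in V(G)$; (iii) if there is an edge of $H$ between $L(u)$ and $L(v)$, then $u=v$ or $uv\in E(G)$; (iv) if $uv\in E(G)$, then the edges of $H$ between $L(u)$ and $L(v)$ form a (possibly empty) matching. The graph $G$ is *$\mathscr{H}$-colourable* if $H$ has an independent set of size $|V(G)|$. For every $\varepsilon>0$ there exist a real $\delta_0>1$ and an integer $\Delta_0\ge 2$ such that the following holds for all integers $\Delta\ge\Delta_0$. For any triangle-free graph $G$ of maximum degree $\Delta$, if $\mathscr{H}=(L,H)$ is a cover of $G$ such that \[ |L(u)| \ge (1+\varepsilon)\max\left\{ \frac{\deg(u)}{\log(\deg(u)/\log \Delta)},\ \frac{\delta_0}{\log\delta_0}\log \Delta\right\} \] for each $u\in V(G)$, then $G$ is $\mathscr{H}$-colourable. Here, if $\deg(u)\le\log\Delta$, the maximum is read as its second argument. -/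

import Mathlib

/-- The pair `(L, H)` is a cover of the graph `G`. A list `L u` may a priori be empty. -/
structure IsCover {V W : Type*} (G : SimpleGraph V) (L : V → Finset W)
    (H : SimpleGraph W) : Prop where
  /-- The lists `L u`, for `u` a vertex of `G`, partition the vertex set of `H`. -/
  partition : ∀ x : W, ∃! u : V, x ∈ L u
  /-- Each list induces a complete subgraph of `H`. -/
  complete : ∀ u : V, H.IsClique (L u : Set W)
  /-- There are edges of `H` between two distinct lists only over an edge of `G`. -/
  eq_or_adj : ∀ u v : V, ∀ x ∈ L u, ∀ y ∈ L v, H.Adj x y → u = v ∨ G.Adj u v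
  /-- The edges of `H` between the lists of two adjacent vertices of `G` form a (possibly empty)
  matching. As `(u, v)` runs over ordered pairs, this says that no two of these edges share an
  endpoint, on either side. -/
  matching : ∀ u v : V, G.Adj u v →
    ∀ x ∈ L u, ∀ y ∈ L v, ∀ y' ∈ L v, H.Adj x y → H.Adj x y' → y = y'

/-- For a cover `(L, H)` of a graph on the finite vertex set `V`, a colouring is an independent
set in `H` of size `|V|`; the graph is colourable if there is one. -/
def CoverColourable (V : Type*) [Fintype V] {W : Type*} (H : SimpleGraph W) : Prop :=
  ∃ I : Finset W, H.IsNIndepSet (Fintype.card V) I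

/-! Choose one colour from every list, uniformly among choices that are conflict-free on `S`. By
induction on `S`, each `v ∉ S` keeps on average at least `l = K log Δ` available colours, so the
count stays positive as vertices are added to `S`. The neighbours `N` of `v` in `S` are independent
in `G`, since `G` is triangle-free. Given the colours on `S \ N`, the colours on `N` are therefore
independent and uniform on their available sets (`sum_conflictFree_mul`). A neighbour with more than
`t` available colours contributes a factor close to an exponential; one with at most `t` is rare, of
probability at most `t / l` by induction (`sum_available_le`). Bounding the exponential by a tangent
line gives an estimate affine in the number of bad neighbours, so it can be averaged directly
(`prod_mul_le_sum_prod_sub`, `mul_count_le`). The list sizes make the resulting numerical condition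
hold (`exists_list_size_parameters`). -/

open Finset Function

/-! ### Product inequalities for missed colours. -/

theorem one_sub_sum_le_prod_one_sub_of_le_one {ι : Type*} (s : Finset ι) (p : ι → ℝ)
    (h0 : ∀ i ∈ s, 0 ≤ p i) (h1 : ∀ i ∈ s, p i ≤ 1) :
    1 - ∑ i ∈ s, p i ≤ ∏ i ∈ s, (1 - p i) := by
  classical
  induction s using Finset.induction_on with
  | empty => simp
  | insert a s ha ih =>
    rw [sum_insert ha, prod_insert ha]
    have h := ih (fun i hi => h0 i (mem_insert_of_mem hi)) (fun i hi => h1 i (mem_insert_of_mem hi))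
    have hs : 0 ≤ ∑ i ∈ s, p i := sum_nonneg fun i hi => h0 i (mem_insert_of_mem hi)
    have ha0 := h0 a (mem_insert_self a s)
    have ha1 := h1 a (mem_insert_self a s)
    nlinarith [mul_le_mul_of_nonneg_left h (sub_nonneg.2 ha1)]

/-- A lower bound, affine in the number of small `k u`, for the number of elements of `X` missed by
independent uniform choices from sets of sizes `k u` that are partially matched into `X`. -/
theorem prod_mul_le_sum_prod_sub {ι X : Type*} (N : Finset ι) (A : Finset X) (k : ι → ℕ)
    (m : ι → X → ℕ) {t : ℕ} (ht : 0 < t) (hm : ∀ u ∈ N, ∀ x ∈ A, m u x ≤ 1)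
    (hmk : ∀ u ∈ N, ∑ x ∈ A, m u x ≤ k u) {a : ℝ} (ha : 0 ≤ a) :
    (∏ u ∈ N, (k u : ℝ)) * (Real.exp (-a) * ((1 + a) *
        ((#A : ℝ) - ∑ u ∈ N, if k u ≤ t then (1 : ℝ) else 0) - (t + 1) / t * #N)) ≤
      ∑ x ∈ A, ∏ u ∈ N, ((k u : ℝ) - m u x) := by
  have hmk' : ∀ u ∈ N, ∀ x ∈ A, (m u x : ℝ) ≤ k u := fun u hu x hx => by
    exact_mod_cast (single_le_sum (f := m u) (fun _ _ => Nat.zero_le _) hx).trans (hmk u hu)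
  by_cases hk : ∃ u ∈ N, k u = 0
  · obtain ⟨u, hu, hk⟩ := hk
    rw [prod_eq_zero hu (by simp [hk]), zero_mul]
    exact sum_nonneg fun x hx => prod_nonneg fun u hu => sub_nonneg.2 (hmk' u hu x hx)
  push Not at hk
  have hk0 : ∀ u ∈ N, (0 : ℝ) < k u := fun u hu => by exact_mod_cast Nat.pos_of_ne_zero (hk u hu)
  have ht' : (0 : ℝ) < t := by exact_mod_cast ht
  set B := N.filter fun u => k u ≤ t with hB
  set C := N.filter fun u => ¬ k u ≤ t with hC
  have hBN : ∀ u ∈ B, u ∈ N := fun u hu => (mem_filter.1 hu).1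
  have hCN : ∀ u ∈ C, u ∈ N := fun u hu => (mem_filter.1 hu).1
  have hCk : ∀ u ∈ C, (t : ℝ) + 1 ≤ k u := fun u hu => by
    exact_mod_cast (not_le.1 (mem_filter.1 hu).2)
  have hfac : ∀ x ∈ A, ∏ u ∈ N, ((k u : ℝ) - m u x) =
      (∏ u ∈ N, (k u : ℝ)) * ∏ u ∈ N, (1 - (m u x : ℝ) / k u) := fun x _ => by
    rw [← prod_mul_distrib]
    refine prod_congr rfl fun u hu => ?_
    have := (hk0 u hu).ne'
    field_simp
  rw [sum_congr rfl hfac, ← mul_sum]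
  refine mul_le_mul_of_nonneg_left ?_ (prod_nonneg fun u hu => (hk0 u hu).le)
  have hpt : ∀ x ∈ A, Real.exp (-a) * ((1 + a) * (1 - ∑ u ∈ B, (m u x : ℝ) / k u)
      - ∑ u ∈ C, (m u x : ℝ) / (k u - 1)) ≤ ∏ u ∈ N, (1 - (m u x : ℝ) / k u) := by
    intro x hx
    rw [← prod_filter_mul_prod_filter_not N (fun u => k u ≤ t)]
    set ρ := ∑ u ∈ C, (m u x : ℝ) / (k u - 1) with hρ
    have hρ0 : 0 ≤ ρ := sum_nonneg fun u hu =>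
      div_nonneg (Nat.cast_nonneg _) (by linarith [hCk u hu])
    -- A factor `1 - 1/k` is the inverse of `1 + 1/(k-1) ≤ exp (1/(k-1))`; hence the `k - 1` in `ρ`.
    have hC1 : Real.exp (-ρ) ≤ ∏ u ∈ C, (1 - (m u x : ℝ) / k u) := by
      rw [hρ, ← sum_neg_distrib, Real.exp_sum]
      refine prod_le_prod (fun _ _ => (Real.exp_pos _).le) fun u hu => ?_
      have h1 := hCk u hu
      have hk1 : (0 : ℝ) < k u - 1 := by linarith
      rcases Nat.le_one_iff_eq_zero_or_eq_one.1 (hm u (hCN u hu) x hx) with h | h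
      · simp [h]
      · rw [h, Nat.cast_one, Real.exp_neg]
        have h2 := Real.add_one_le_exp (1 / ((k u : ℝ) - 1))
        have h3 : 1 / ((k u : ℝ) - 1) + 1 = k u / (k u - 1) := by field_simp; ring
        rw [h3] at h2
        have h4 : (0 : ℝ) < k u / (k u - 1) := div_pos (by linarith) hk1
        calc _ ≤ ((k u : ℝ) / (k u - 1))⁻¹ := inv_anti₀ h4 h2
          _ = _ := by
            have : (k u : ℝ) ≠ 0 := by linarith
            field_simp
    have hp0 : ∀ u ∈ B, 0 ≤ (m u x : ℝ) / k u := fun u hu => by positivity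
    have hp1 : ∀ u ∈ B, (m u x : ℝ) / k u ≤ 1 := fun u hu =>
      (div_le_one (hk0 u (hBN u hu))).2 (hmk' u (hBN u hu) x hx)
    have hB1 := one_sub_sum_le_prod_one_sub_of_le_one B _ hp0 hp1
    set b := ∏ u ∈ B, (1 - (m u x : ℝ) / k u) with hb
    have hb0 : 0 ≤ b := prod_nonneg fun u hu => sub_nonneg.2 (hp1 u hu)
    have hb1 : b ≤ 1 := prod_le_one (fun u hu => sub_nonneg.2 (hp1 u hu))
      fun u hu => by linarith [hp0 u hu]
    -- Tangent line to `exp (-ρ)` at `ρ = a`: after summing over colours, only the total of the `ρ`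
    -- matters.
    have he : Real.exp (-a) * (1 + a - ρ) ≤ Real.exp (-ρ) := by
      have h := Real.add_one_le_exp (a - ρ)
      calc _ ≤ Real.exp (-a) * Real.exp (a - ρ) := by gcongr; linarith
        _ = _ := by rw [← Real.exp_add]; congr 1; ring
    calc _ ≤ Real.exp (-a) * (b * (1 + a - ρ)) := by
          gcongr
          nlinarith
      _ = b * (Real.exp (-a) * (1 + a - ρ)) := by ring
      _ ≤ _ := by gcongr; exact he.trans hC1
  refine le_trans ?_ (sum_le_sum hpt)
  rw [← mul_sum, sum_sub_distrib, ← mul_sum, sum_sub_distrib, sum_comm (s := A) (t := B),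
    sum_comm (s := A) (t := C), ← sum_filter]
  -- A small available set costs at most 1 in total over all colours, whatever its size.
  have hsB : ∑ u ∈ B, ∑ x ∈ A, (m u x : ℝ) / k u ≤ ∑ u ∈ B, (1 : ℝ) := by
    refine sum_le_sum fun u hu => ?_
    rw [← sum_div, div_le_one (hk0 u (hBN u hu))]
    exact_mod_cast hmk u (hBN u hu)
  have hsC : ∑ u ∈ C, ∑ x ∈ A, (m u x : ℝ) / (k u - 1) ≤ (t + 1) / t * #N := by
    calc _ ≤ ∑ u ∈ C, ((t : ℝ) + 1) / t := by
          refine sum_le_sum fun u hu => ?_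
          have h1 := hCk u hu
          have h2 : ∑ x ∈ A, (m u x : ℝ) ≤ k u := by exact_mod_cast hmk u (hCN u hu)
          rw [← sum_div, div_le_div_iff₀ (by linarith) ht']
          nlinarith
      _ = (t + 1) / t * #C := by rw [sum_const, nsmul_eq_mul, mul_comm]
      _ ≤ _ := by gcongr; exact filter_subset _ _
  gcongr
  simp

/-! ### Resampling coordinates in a product of lists. -/

section Resample

variable {V W : Type*} [Fintype V] [DecidableEq V]

/-- Exchanging the new colour `x` with the old colour `c v` is an involution on pairs `(c, x)`. -/
theorem sum_piFinset_sum_update (L : V → Finset W) (v : V) (g : (V → W) → ℝ) :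
    ∑ c ∈ Fintype.piFinset L, ∑ x ∈ L v, g (update c v x) =
      #(L v) * ∑ c ∈ Fintype.piFinset L, g c := by
  have : (#(L v) : ℝ) * ∑ c ∈ Fintype.piFinset L, g c =
      ∑ c ∈ Fintype.piFinset L, ∑ _x ∈ L v, g c := by
    rw [mul_sum]; simp
  rw [this, ← sum_product', ← sum_product']
  have hmem : ∀ p ∈ Fintype.piFinset L ×ˢ L v,
      (update p.1 v p.2, p.1 v) ∈ Fintype.piFinset L ×ˢ L v := by
    rintro ⟨c, x⟩ hp
    simp only [mem_product, Fintype.mem_piFinset] at hp ⊢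
    refine ⟨fun u => ?_, hp.1 v⟩
    by_cases h : u = v
    · subst h; simpa using hp.2
    · simpa [h] using hp.1 u
  refine sum_nbij' (fun p => (update p.1 v p.2, p.1 v)) (fun p => (update p.1 v p.2, p.1 v))
    hmem hmem ?_ ?_ ?_ <;> simp

/-- Coordinates that occur only through their own factors may be averaged independently. -/
theorem sum_piFinset_mul_prod (L : V → Finset W) (hL : ∀ u, (L u).Nonempty) (N : Finset V)
    (w : (V → W) → ℝ) (f : V → (V → W) → W → ℝ)
    (hw : ∀ u ∈ N, ∀ c y, w (update c u y) = w c)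
    (hf : ∀ u' ∈ N, ∀ u ∈ N, ∀ c y z, f u' (update c u y) z = f u' c z) :
    ∑ c ∈ Fintype.piFinset L, w c * ∏ u ∈ N, f u c (c u) =
      ∑ c ∈ Fintype.piFinset L, w c * ∏ u ∈ N, ((∑ y ∈ L u, f u c y) / #(L u)) := by
  induction N using Finset.induction_on generalizing w with
  | empty => simp
  | insert v N hv ih =>
    have hLv : (#(L v) : ℝ) ≠ 0 := by exact_mod_cast (hL v).card_pos.ne'
    have hmv := mem_insert_self v N
    have hmN : ∀ u ∈ N, u ∈ insert v N := fun u hu => mem_insert_of_mem hu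
    have hne : ∀ u ∈ N, u ≠ v := fun u hu h => hv (h ▸ hu)
    have h1 := sum_piFinset_sum_update L v fun c => w c * ∏ u ∈ insert v N, f u c (c u)
    have h2 : ∀ c, ∑ x ∈ L v, w (update c v x) *
        ∏ u ∈ insert v N, f u (update c v x) (update c v x u) =
        #(L v) * (w c * ((∑ y ∈ L v, f v c y) / #(L v)) * ∏ u ∈ N, f u c (c u)) := fun c => by
      have : ∀ x ∈ L v, w (update c v x) *
          ∏ u ∈ insert v N, f u (update c v x) (update c v x u) =
          (w c * ∏ u ∈ N, f u c (c u)) * f v c x := fun x _ => by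
        rw [prod_insert hv, hw v hmv, hf v hmv v hmv, update_self, prod_congr rfl
          fun u hu => by rw [hf u (hmN u hu) v hmv, update_of_ne (hne u hu)]]
        ring
      rw [sum_congr rfl this, ← mul_sum]
      field_simp
    simp only [h2, ← mul_sum] at h1
    rw [← mul_left_cancel₀ hLv h1, ih _ (fun u hu c y => ?_)
      fun u' hu' u hu => hf u' (hmN u' hu') u (hmN u hu)]
    · refine sum_congr rfl fun c _ => ?_
      rw [prod_insert hv]; ring
    · simp only [hw u (hmN u hu), hf v hmv u (hmN u hu)]

end Resample

/-! ### Conflict-free choices and the inductive count. -/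

section Counting

open Classical in
/-- The vertices of `L u` not adjacent in `H` to the colours that `c` gives to `S`. -/
noncomputable def available {V W : Type*} (L : V → Finset W) (H : SimpleGraph W) (S : Finset V)
    (c : V → W) (u : V) : Finset W :=
  (L u).filter fun y => ∀ w ∈ S, ¬ H.Adj y (c w)

/-- No two colours that `c` gives to vertices of `S` are adjacent in `H`. -/
def ConflictFree {V W : Type*} (H : SimpleGraph W) (S : Finset V) (c : V → W) : Prop :=
  ∀ u ∈ S, ∀ w ∈ S, ¬ H.Adj (c u) (c w)

open Classical in
/-- The number of choices of one vertex in each list `L u` that are conflict-free on `S`. -/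
noncomputable def conflictFreeCount {V W : Type*} [Fintype V] [DecidableEq V] (L : V → Finset W)
    (H : SimpleGraph W) (S : Finset V) : ℝ :=
  ∑ c ∈ Fintype.piFinset L, if ConflictFree H S c then 1 else 0

variable {V W : Type*} {G : SimpleGraph V} {L : V → Finset W} {H : SimpleGraph W}

theorem mem_available {S : Finset V} {c : V → W} {u : V} {y : W} :
    y ∈ available L H S c u ↔ y ∈ L u ∧ ∀ w ∈ S, ¬ H.Adj y (c w) := by
  classical exact mem_filter

theorem available_congr {S : Finset V} {c d : V → W} (h : ∀ w ∈ S, c w = d w) (u : V) :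
    available L H S c u = available L H S d u := by
  ext y
  simp only [mem_available]
  exact and_congr_right fun _ => forall₂_congr fun w hw => by rw [h w hw]

theorem conflictFree_congr {S : Finset V} {c d : V → W} (h : ∀ w ∈ S, c w = d w) :
    ConflictFree H S c ↔ ConflictFree H S d :=
  forall₂_congr fun u hu => forall₂_congr fun w hw => by rw [h u hu, h w hw]

theorem available_update [DecidableEq V] {S : Finset V} {v : V} (hv : v ∉ S) (c : V → W) (y : W)
    (u : V) : available L H S (update c v y) u = available L H S c u :=
  available_congr (fun _ hw => update_of_ne (ne_of_mem_of_not_mem hw hv) _ _) u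

theorem conflictFree_update [DecidableEq V] {S : Finset V} {v : V} (hv : v ∉ S) (c : V → W)
    (y : W) : ConflictFree H S (update c v y) ↔ ConflictFree H S c :=
  conflictFree_congr fun _ hw => update_of_ne (ne_of_mem_of_not_mem hw hv) _ _

/-- Only colours on `G`-neighbours restrict availability. -/
theorem IsCover.available_eq (hc : IsCover G L H) {S T : Finset V} {u : V}
    (hTS : T ⊆ S) (hu : u ∉ S) (hN : ∀ w ∈ S, G.Adj u w → w ∈ T) {c : V → W}
    (hcL : ∀ w, c w ∈ L w) : available L H S c u = available L H T c u := by
  ext y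
  simp only [mem_available]
  refine and_congr_right fun hy => ⟨fun h w hw => h w (hTS hw), fun h w hw hadj => ?_⟩
  rcases hc.eq_or_adj u w y hy (c w) (hcL w) hadj with rfl | h'
  · exact hu hw
  · exact h w (hN w hw h') hadj

/-- Edges of `H` between different lists lie over edges of `G`, so no conflict arises inside the
independent set `N`. What remains is one separate condition per vertex of `N`. -/
theorem IsCover.conflictFree_iff (hc : IsCover G L H) [DecidableEq V] {S N : Finset V}
    (hNS : N ⊆ S) (hN : ∀ u ∈ N, ∀ w ∈ N, ¬ G.Adj u w) {c : V → W} (hcL : ∀ w, c w ∈ L w) :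
    ConflictFree H S c ↔
      ConflictFree H (S \ N) c ∧ ∀ u ∈ N, c u ∈ available L H (S \ N) c u := by
  simp only [mem_available]
  constructor
  · exact fun h => ⟨fun u hu w hw => h u (mem_sdiff.1 hu).1 w (mem_sdiff.1 hw).1,
      fun u hu => ⟨hcL u, fun w hw => h u (hNS hu) w (mem_sdiff.1 hw).1⟩⟩
  · rintro ⟨h1, h2⟩ u hu w hw hadj
    by_cases huN : u ∈ N <;> by_cases hwN : w ∈ N
    · rcases hc.eq_or_adj u w _ (hcL u) _ (hcL w) hadj with rfl | h'
      · exact H.loopless.irrefl _ hadj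
      · exact hN u huN w hwN h'
    · exact (h2 u huN).2 w (mem_sdiff.2 ⟨hw, hwN⟩) hadj
    · exact (h2 w hwN).2 u (mem_sdiff.2 ⟨hu, huN⟩) hadj.symm
    · exact h1 u (mem_sdiff.2 ⟨hu, huN⟩) w (mem_sdiff.2 ⟨hw, hwN⟩) hadj

variable [Fintype V] [DecidableEq V]

open Classical in
/-- Choosing the colours of an independent set `N` last: each is uniform among those available. -/
theorem IsCover.sum_conflictFree_mul (hc : IsCover G L H) (hL : ∀ u, (L u).Nonempty)
    {S N : Finset V} (hNS : N ⊆ S) (hN : ∀ u ∈ N, ∀ w ∈ N, ¬ G.Adj u w) (w : (V → W) → ℝ)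
    (hw : ∀ u ∈ N, ∀ c y, w (update c u y) = w c) (Q : V → W → Prop)
    [∀ u, DecidablePred (Q u)] :
    ∑ c ∈ Fintype.piFinset L,
        (if ConflictFree H S c then w c * ∏ u ∈ N, (if Q u (c u) then (1 : ℝ) else 0) else 0) =
      ∑ c ∈ Fintype.piFinset L, (if ConflictFree H (S \ N) c then w c else 0) *
        ∏ u ∈ N, ((#((available L H (S \ N) c u).filter (Q u)) : ℝ) / #(L u)) := by
  have hnot : ∀ u ∈ N, u ∉ S \ N := fun u hu h => (mem_sdiff.1 h).2 hu
  have key := sum_piFinset_mul_prod L hL N (fun c => if ConflictFree H (S \ N) c then w c else 0)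
    (fun u c y => if y ∈ available L H (S \ N) c u ∧ Q u y then 1 else 0)
    (fun u hu c y => by simp only [conflictFree_update (hnot u hu), hw u hu])
    (fun u' _ u hu c y z => by simp only [available_update (hnot u hu)])
  have hcard : ∀ c u, ∑ y ∈ L u, (if y ∈ available L H (S \ N) c u ∧ Q u y then (1 : ℝ) else 0) =
      #((available L H (S \ N) c u).filter (Q u)) := fun c u => by
    rw [sum_boole]
    congr 2
    ext y
    simp only [mem_filter, mem_available]
    tauto
  simp only [hcard] at key
  rw [← key]
  refine sum_congr rfl fun c hcp => ?_
  rw [Fintype.mem_piFinset] at hcp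
  rw [prod_ite_zero, prod_ite_zero, prod_const_one]
  simp only [hc.conflictFree_iff hNS hN hcp]
  by_cases h1 : ConflictFree H (S \ N) c <;>
    by_cases h2 : ∀ u ∈ N, c u ∈ available L H (S \ N) c u <;>
    by_cases h3 : ∀ u ∈ N, Q u (c u)
  all_goals simp only [h1, h2, h3, forall_and, true_and, false_and, and_false,
    if_true, if_false, mul_zero, zero_mul]
  all_goals simp_all

-- Being conflict-free on `S` does not constrain the colour of `v`, so that colour can be resampled.
-- Divided by the count for `S`, both sides become the mean number of colours available at `v`.
open Classical in
theorem IsCover.count_insert (hc : IsCover G L H) {S : Finset V} {v : V} (hv : v ∉ S) :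
    #(L v) * conflictFreeCount L H (insert v S) =
      ∑ c ∈ Fintype.piFinset L,
        if ConflictFree H S c then (#(available L H S c v) : ℝ) else 0 := by
  rw [conflictFreeCount, ← sum_piFinset_sum_update]
  refine sum_congr rfl fun c hcp => ?_
  rw [Fintype.mem_piFinset] at hcp
  have h : ∀ x ∈ L v, (if ConflictFree H (insert v S) (update c v x) then (1 : ℝ) else 0) =
      if ConflictFree H S c then (if x ∈ available L H S c v then 1 else 0) else 0 := by
    intro x hx
    have hx' : ∀ w, update c v x w ∈ L w := fun w => by
      by_cases h : w = v
      · subst h; simpa using hx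
      · simpa [h] using hcp w
    rw [← ite_and, hc.conflictFree_iff (N := {v}) (by simp) (by simp) hx']
    have : insert v S \ {v} = S := by
      rw [sdiff_singleton_eq_erase, erase_insert hv]
    simp [this, conflictFree_update hv, available_update hv]
  rw [sum_congr rfl h]
  split_ifs
  · rw [sum_boole]
    congr 2
    ext x
    simp only [mem_filter, mem_available]
    tauto
  · simp

theorem conflictFreeCount_nonneg (S : Finset V) : 0 ≤ conflictFreeCount L H S := by
  classical exact sum_nonneg fun c _ => by split_ifs <;> norm_num

open Classical in
/-- Few conflict-free choices leave a vertex `u` of `S` at most `t` colours. -/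
theorem IsCover.sum_available_le (hc : IsCover G L H) (hL : ∀ u, (L u).Nonempty) {S : Finset V}
    {u : V} (hu : u ∈ S) (t : ℕ) :
    #(L u) * (∑ c ∈ Fintype.piFinset L, if ConflictFree H S c then
        (if #(available L H (S.erase u) c u) ≤ t then (1 : ℝ) else 0) else 0) ≤
      t * conflictFreeCount L H (S.erase u) := by
  have hLu : (0 : ℝ) < #(L u) := by exact_mod_cast (hL u).card_pos
  -- With the other colours fixed, the colour of `u` must fall among at most `t` of the `#(L u)`
  -- colours.
  have h := hc.sum_conflictFree_mul hL (S := S) (N := {u}) (by simpa) (by simp)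
    (fun c => if #(available L H (S.erase u) c u) ≤ t then (1 : ℝ) else 0)
    (fun w hw c y => by
      rw [mem_singleton] at hw
      subst hw
      simp only [available_update (notMem_erase w S)]) (fun _ _ => True)
  simp only [if_true, prod_const_one, mul_one, sdiff_singleton_eq_erase, prod_singleton,
    filter_true] at h
  rw [h, conflictFreeCount, mul_sum, mul_sum]
  refine sum_le_sum fun c _ => ?_
  split_ifs with h1 h2
  · rw [one_mul, mul_div_cancel₀ _ hLu.ne', mul_one]
    exact_mod_cast h2
  · simp
  · simp

/-- The counting step. -/
theorem IsCover.mul_count_le (hc : IsCover G L H) [DecidableRel G.Adj] (hG : G.CliqueFree 3)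
    (hL : ∀ u, (L u).Nonempty) {l : ℝ} (hl : 0 < l) {t : ℕ} (ht : 0 < t) {S : Finset V} {v : V}
    (hv : v ∉ S)
    (ih : ∀ u ∈ S, l * conflictFreeCount L H (S.erase u) ≤ #(L u) * conflictFreeCount L H S)
    {a : ℝ} (ha : 0 ≤ a) (hla : l ≤ Real.exp (-a) *
      ((1 + a) * (#(L v) - G.degree v * t / l) - (t + 1) / t * G.degree v)) :
    l * conflictFreeCount L H S ≤ #(L v) * conflictFreeCount L H (insert v S) := by
  classical
  set N := S.filter (G.Adj v) with hNdef
  have hNS : N ⊆ S := filter_subset _ _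
  have hadj : ∀ u ∈ N, G.Adj v u := fun u hu => (mem_filter.1 hu).2
  have hN : ∀ u ∈ N, ∀ w ∈ N, ¬ G.Adj u w := fun u hu w hw h =>
    hG {v, u, w} (SimpleGraph.is3Clique_triple_iff.2 ⟨hadj u hu, hadj w hw, h⟩)
  have hNdeg : (#N : ℝ) ≤ G.degree v := by
    rw [← G.card_neighborFinset_eq_degree v]
    exact_mod_cast card_le_card fun u hu => (G.mem_neighborFinset v u).2 (hadj u hu)
  have hnot : ∀ u ∈ N, u ∉ S \ N := fun u hu h => (mem_sdiff.1 h).2 hu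
  have ht' : (0 : ℝ) < t := by exact_mod_cast ht
  have hLpos : ∀ u, (0 : ℝ) < #(L u) := fun u => by exact_mod_cast (hL u).card_pos
  set T := S \ N with hT
  set Z := conflictFreeCount L H S with hZ
  have hZ0 : 0 ≤ Z := conflictFreeCount_nonneg S
  -- the weight of the choices outside `N`
  set P : (V → W) → ℝ := fun c => (if ConflictFree H T c then 1 else 0) *
    ∏ u ∈ N, ((#(available L H T c u) : ℝ) / #(L u)) with hP
  have hP0 : ∀ c, 0 ≤ (if ConflictFree H T c then (1 : ℝ) else 0) / ∏ u ∈ N, (#(L u) : ℝ) :=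
    fun c => div_nonneg (by split_ifs <;> norm_num) (prod_nonneg fun u _ => (hLpos u).le)
  have hZP : Z = ∑ c ∈ Fintype.piFinset L, P c := by
    have h := hc.sum_conflictFree_mul hL hNS hN (fun _ => 1) (fun _ _ _ _ => rfl)
      (fun _ _ => True)
    simp only [if_true, prod_const_one, mul_one, filter_true] at h
    exact h
  have hbad : ∀ u ∈ N, ∑ c ∈ Fintype.piFinset L,
      P c * (if #(available L H T c u) ≤ t then 1 else 0) ≤ t / l * Z := by
    intro u hu
    have h := hc.sum_conflictFree_mul hL hNS hN
      (fun c => if #(available L H T c u) ≤ t then (1 : ℝ) else 0)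
      (fun w hw c y => by simp only [available_update (hnot w hw)]) (fun _ _ => True)
    simp only [if_true, prod_const_one, mul_one, filter_true] at h
    have h1 : ∑ c ∈ Fintype.piFinset L,
        P c * (if #(available L H T c u) ≤ t then 1 else 0) =
        ∑ c ∈ Fintype.piFinset L, if ConflictFree H S c then
          (if #(available L H (S.erase u) c u) ≤ t then (1 : ℝ) else 0) else 0 := by
      trans ∑ c ∈ Fintype.piFinset L, if ConflictFree H S c then
          (if #(available L H T c u) ≤ t then (1 : ℝ) else 0) else 0
      · rw [h]
        refine sum_congr rfl fun c _ => ?_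
        simp only [hP]
        split_ifs <;> ring
      · refine sum_congr rfl fun c hcp => ?_
        rw [Fintype.mem_piFinset] at hcp
        -- As `N` is independent, all neighbours of `u` in `S` lie in `T`, so the colours on `N` do
        -- not affect what is available at `u`.
        rw [hc.available_eq (S := S.erase u) (T := T) (u := u) ?_ (notMem_erase u S) ?_ hcp]
        · intro w hw
          exact mem_erase.2 ⟨fun h => hnot u hu (h ▸ hw), (mem_sdiff.1 hw).1⟩
        · intro w hw huw
          exact mem_sdiff.2 ⟨(mem_erase.1 hw).2, fun hwN => hN u hu w hwN huw⟩
    rw [h1]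
    have h2 := hc.sum_available_le hL (hNS hu) t
    have h3 := ih u (hNS hu)
    rw [div_mul_eq_mul_div, le_div_iff₀ hl]
    refine le_of_mul_le_mul_left ?_ (hLpos u)
    nlinarith [mul_le_mul_of_nonneg_left h3 ht'.le, mul_le_mul_of_nonneg_right h2 hl.le]
  have hstep : #(L v) * conflictFreeCount L H (insert v S) =
      ∑ c ∈ Fintype.piFinset L, (if ConflictFree H T c then (1 : ℝ) else 0) / (∏ u ∈ N, (#(L u) : ℝ)) *
        ∑ x ∈ L v, ∏ u ∈ N, ((#(available L H T c u) : ℝ) -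
          #((available L H T c u).filter (H.Adj x))) := by
    rw [hc.count_insert hv]
    have h1 : ∀ c ∈ Fintype.piFinset L,
        (if ConflictFree H S c then (#(available L H S c v) : ℝ) else 0) =
        ∑ x ∈ L v, if ConflictFree H S c then
          1 * ∏ u ∈ N, (if ¬ H.Adj x (c u) then (1 : ℝ) else 0) else 0 := by
      intro c hcp
      rw [Fintype.mem_piFinset] at hcp
      rw [hc.available_eq hNS hv (fun w hw h => mem_filter.2 ⟨hw, h⟩) hcp]
      split_ifs
      · simp only [prod_ite_zero, prod_const_one, one_mul, sum_boole]
        congr 2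
        ext y
        simp [mem_available]
      · simp
    rw [sum_congr rfl h1, sum_comm]
    simp only [mul_sum]
    rw [sum_comm (s := Fintype.piFinset L)]
    refine sum_congr rfl fun x _ => ?_
    rw [hc.sum_conflictFree_mul hL hNS hN (fun _ => 1) (fun _ _ _ _ => rfl)
      (fun _ y => ¬ H.Adj x y)]
    refine sum_congr rfl fun c _ => ?_
    rw [prod_div_distrib, div_mul_eq_mul_div, mul_div_assoc]
    congr 3
    funext u
    rw [eq_sub_iff_add_eq]
    exact_mod_cast (add_comm _ _).trans
      (card_filter_add_card_filter_not (s := available L H T c u) (H.Adj x))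
  have hpoint : ∀ c, P c * (Real.exp (-a) * ((1 + a) *
        ((#(L v) : ℝ) - ∑ u ∈ N, if #(available L H T c u) ≤ t then (1 : ℝ) else 0) -
          (t + 1) / t * #N)) ≤
      (if ConflictFree H T c then (1 : ℝ) else 0) / (∏ u ∈ N, (#(L u) : ℝ)) *
        ∑ x ∈ L v, ∏ u ∈ N, ((#(available L H T c u) : ℝ) -
          #((available L H T c u).filter (H.Adj x))) := by
    intro c
    -- The matching is used from both sides: a colour of `v` blocks at most one colour of `u`, and
    -- each available colour of `u` blocks at most one colour of `v`.
    have h := prod_mul_le_sum_prod_sub N (L v) (fun u => #(available L H T c u))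
      (fun u x => #((available L H T c u).filter (H.Adj x))) ht
      (fun u hu x hx => card_le_one.2 fun y hy y' hy' => by
        rw [mem_filter, mem_available] at hy hy'
        exact hc.matching v u (hadj u hu) x hx y hy.1.1 y' hy'.1.1 hy.2 hy'.2)
      (fun u hu => by
        simp only [card_filter]
        rw [sum_comm]
        calc _ ≤ ∑ y ∈ available L H T c u, 1 := sum_le_sum fun y hy => by
              rw [← card_filter]
              refine card_le_one.2 fun x hx x' hx' => ?_
              rw [mem_filter] at hx hx'
              exact hc.matching u v (hadj u hu).symm y (mem_available.1 hy).1 x hx.1 x' hx'.1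
                hx.2.symm hx'.2.symm
          _ = _ := by simp)
      ha
    refine le_trans (le_of_eq ?_) (mul_le_mul_of_nonneg_left h (hP0 c))
    simp only [hP, prod_div_distrib]
    ring
  rw [hstep]
  refine le_trans ?_ (sum_le_sum fun c _ => hpoint c)
  have hsum : ∑ c ∈ Fintype.piFinset L, P c * (Real.exp (-a) * ((1 + a) *
        ((#(L v) : ℝ) - ∑ u ∈ N, if #(available L H T c u) ≤ t then (1 : ℝ) else 0) -
          (t + 1) / t * #N)) =
      Real.exp (-a) * ((1 + a) * (#(L v) * Z - ∑ u ∈ N, ∑ c ∈ Fintype.piFinset L,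
        P c * (if #(available L H T c u) ≤ t then 1 else 0)) - (t + 1) / t * #N * Z) := by
    rw [hZP, sum_comm (s := N), mul_sum, mul_sum, ← sum_sub_distrib, mul_sum, ← sum_sub_distrib,
      mul_sum]
    refine sum_congr rfl fun c _ => ?_
    rw [← mul_sum]
    ring
  rw [hsum]
  have hb : ∑ u ∈ N, ∑ c ∈ Fintype.piFinset L,
      P c * (if #(available L H T c u) ≤ t then 1 else 0) ≤ G.degree v * t / l * Z := by
    calc _ ≤ ∑ u ∈ N, t / l * Z := sum_le_sum hbad
      _ = #N * (t / l * Z) := by rw [sum_const, nsmul_eq_mul]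
      _ ≤ G.degree v * (t / l * Z) := by gcongr
      _ = _ := by ring
  calc l * Z ≤ Real.exp (-a) * ((1 + a) * (#(L v) - G.degree v * t / l) -
        (t + 1) / t * G.degree v) * Z := by gcongr
    _ = Real.exp (-a) * ((1 + a) * (#(L v) * Z - G.degree v * t / l * Z) -
        (t + 1) / t * G.degree v * Z) := by ring
    _ ≤ _ := by gcongr

/-- Every ratio of successive counts is positive, starting from the nonempty product of all lists.
The tangent point `a` may vary with `v`, but `l` and `t` must be uniform for the induction. -/
theorem IsCover.colourable_of_count (hc : IsCover G L H) [DecidableRel G.Adj]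
    (hG : G.CliqueFree 3) {l : ℝ} (hl : 0 < l) {t : ℕ} (ht : 0 < t)
    (hla : ∀ v, ∃ a : ℝ, 0 ≤ a ∧ l ≤ Real.exp (-a) *
      ((1 + a) * (#(L v) - G.degree v * t / l) - (t + 1) / t * G.degree v)) :
    CoverColourable V H := by
  classical
  have hL : ∀ u, (L u).Nonempty := fun u => by
    obtain ⟨a, ha, h⟩ := hla u
    by_contra hne
    rw [not_nonempty_iff_eq_empty] at hne
    rw [hne, card_empty, Nat.cast_zero, zero_sub] at h
    have h1 : 0 ≤ (1 + a) * (G.degree u * t / l) := by positivity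
    have h2 : 0 ≤ ((t : ℝ) + 1) / t * G.degree u := by positivity
    have h3 := mul_nonneg (Real.exp_pos (-a)).le (add_nonneg h1 h2)
    nlinarith
  -- The step at `S` needs the bound at every `S.erase u`, so the induction is on size, over all
  -- sets at once.
  have hstep : ∀ n : ℕ, ∀ S : Finset V, #S = n → ∀ v ∉ S,
      l * conflictFreeCount L H S ≤ #(L v) * conflictFreeCount L H (insert v S) := by
    intro n
    induction n with
    | zero =>
      intro S hS v hv
      obtain ⟨a, ha, h⟩ := hla v
      rw [card_eq_zero] at hS
      subst hS
      exact hc.mul_count_le hG hL hl ht hv (by simp) ha h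
    | succ n ih =>
      intro S hS v hv
      obtain ⟨a, ha, h⟩ := hla v
      refine hc.mul_count_le hG hL hl ht hv (fun u hu => ?_) ha h
      have := ih (S.erase u) (by rw [card_erase_of_mem hu, hS]; rfl) u (notMem_erase u S)
      rwa [insert_erase hu] at this
  have hpos : ∀ S : Finset V, 0 < conflictFreeCount L H S := by
    intro S
    induction S using Finset.induction_on with
    | empty =>
      refine sum_pos (fun c _ => ?_) (Fintype.piFinset_nonempty.2 hL)
      rw [if_pos (by simp [ConflictFree])]
      exact one_pos
    | insert v S hv ih =>
      exact pos_of_mul_pos_right ((mul_pos hl ih).trans_le (hstep _ S rfl v hv))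
        (Nat.cast_nonneg _)
  obtain ⟨c, hcp, hcne⟩ := exists_ne_zero_of_sum_ne_zero (hpos univ).ne'
  rw [Fintype.mem_piFinset] at hcp
  have hcf : ConflictFree H univ c := by
    by_contra h
    exact hcne (if_neg h)
  have hinj : Injective c := fun u w h =>
    (hc.partition (c u)).unique (hcp u) (h ▸ hcp w)
  refine ⟨univ.image c, ?_, ?_⟩
  · intro x hx y hy _
    simp only [coe_image, coe_univ, Set.image_univ, Set.mem_range] at hx hy
    obtain ⟨u, rfl⟩ := hx
    obtain ⟨w, rfl⟩ := hy
    exact hcf u (mem_univ _) w (mem_univ _)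
  · rw [card_image_of_injective _ hinj, card_univ]

end Counting

/-! ### Choice of parameters. -/

open Filter in
theorem exists_forall_mul_log_le_rpow {β C : ℝ} (hβ : 0 < β) (hC : 0 < C) :
    ∃ x₀ : ℝ, 1 < x₀ ∧ ∀ x, x₀ ≤ x → C * Real.log x ≤ x ^ β := by
  have h := ((isLittleO_log_rpow_atTop hβ).bound (inv_pos.2 hC)).and (eventually_gt_atTop 1)
  obtain ⟨x₀, hx₀⟩ := eventually_atTop.1 h
  refine ⟨x₀, (hx₀ x₀ le_rfl).2, fun x hx => ?_⟩
  obtain ⟨h1, h2⟩ := hx₀ x hx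
  have h3 := Real.rpow_nonneg (zero_le_one.trans h2.le) β
  rw [Real.norm_of_nonneg (Real.log_pos h2).le, Real.norm_of_nonneg h3, inv_mul_eq_div,
    le_div_iff₀ hC] at h1
  linarith

/-- The size condition on the lists provides the parameters of the counting argument. -/
theorem exists_list_size_parameters {ε : ℝ} (hε : 0 < ε) :
    ∃ δ₀ : ℝ, 1 < δ₀ ∧ ∃ Δ₀ : ℕ, 2 ≤ Δ₀ ∧ ∃ t : ℕ, 0 < t ∧ ∃ K : ℝ, 0 < K ∧
      ∀ Δ : ℕ, Δ₀ ≤ Δ → 0 < Real.log Δ ∧ ∀ D : ℕ, D ≤ Δ → ∀ M : ℝ,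
        (1 + ε) * max ((D : ℝ) / Real.log (D / Real.log Δ)) (δ₀ / Real.log δ₀ * Real.log Δ) ≤ M →
        ∃ a : ℝ, 0 ≤ a ∧ K * Real.log Δ ≤ Real.exp (-a) *
          ((1 + a) * (M - D * t / (K * Real.log Δ)) - (t + 1) / t * D) := by
  obtain ⟨t, ht⟩ := exists_nat_gt (4 / ε)
  have ht0 : (0 : ℝ) < t := (by positivity : (0 : ℝ) < 4 / ε).trans ht
  have hτ : ((t : ℝ) + 1) / t ≤ 1 + ε / 4 := by
    rw [div_lt_iff₀ hε] at ht
    rw [div_le_iff₀ ht0]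
    nlinarith
  -- `η` is the share of `M` given up to bad neighbours; `K = t / η` makes that loss `η * D / log
  -- Δ`, which is at most `η * M`.
  set η : ℝ := ε / 4 / (1 + ε / 2) with hη
  have hη0 : 0 < η := by positivity
  have hη1 : (1 - η) * (1 + ε / 2) = 1 + ε / 4 := by rw [hη]; field_simp; ring
  have hη2 : 0 < 1 - η := by
    by_contra! h
    nlinarith
  set K : ℝ := t / η with hK
  have hK0 : 0 < K := by positivity
  set β : ℝ := ε / 2 / (1 + ε) with hβ
  have hβ0 : 0 < β := by positivity
  obtain ⟨δ₀, hδ₀, hlog⟩ := exists_forall_mul_log_le_rpow hβ0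
    (show 0 < K / ((1 - η) * (1 + ε)) by positivity)
  obtain ⟨Δ₀, hΔ₀⟩ := exists_nat_gt (max (max (Real.exp 1) δ₀) 2)
  simp only [max_lt_iff] at hΔ₀
  refine ⟨δ₀, hδ₀, Δ₀, by exact_mod_cast hΔ₀.2.le, t, by exact_mod_cast ht0, K, hK0,
    fun Δ hΔ => ?_⟩
  have hΔ' : (Δ₀ : ℝ) ≤ Δ := by exact_mod_cast hΔ
  set s := Real.log Δ with hs
  have hs1 : 1 ≤ s := by
    rw [hs, Real.le_log_iff_exp_le (by linarith)]
    linarith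
  have hs0 : 0 < s := by linarith
  refine ⟨hs0, fun D hD M hM => ?_⟩
  obtain ⟨x, hx, hDx, hxs, hMx⟩ : ∃ x, δ₀ ≤ x ∧ (D : ℝ) ≤ x * s ∧ Real.log x ≤ s ∧
      (1 + ε) * (x / Real.log x * s) ≤ M := by
    have h1 := mul_le_mul_of_nonneg_left
      (le_max_left ((D : ℝ) / Real.log (D / s)) (δ₀ / Real.log δ₀ * s)) (by linarith : 0 ≤ 1 + ε)
    have h2 := mul_le_mul_of_nonneg_left
      (le_max_right ((D : ℝ) / Real.log (D / s)) (δ₀ / Real.log δ₀ * s)) (by linarith : 0 ≤ 1 + ε)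
    -- Here `x` is the larger of `D / s` and `δ₀`. The first argument of the maximum is used only
    -- when `D / s ≥ δ₀ > 1`, so its values for `D ≤ log Δ` play no role.
    rcases le_total ((D : ℝ) / s) δ₀ with h | h
    · exact ⟨δ₀, le_rfl, (div_le_iff₀ hs0).1 h, Real.log_le_log (by linarith) (by linarith),
        h2.trans hM⟩
    · refine ⟨D / s, h, by rw [div_mul_cancel₀ _ hs0.ne'], ?_, le_trans (le_of_eq ?_) (h1.trans hM)⟩
      · refine Real.log_le_log (by linarith) ((div_le_self (Nat.cast_nonneg _) hs1).trans ?_)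
        exact_mod_cast hD
      · field_simp
  have hx1 : 1 < x := hδ₀.trans_le hx
  have hx0 : 0 < x := by linarith
  have hlx : 0 < Real.log x := Real.log_pos hx1
  have hM0 : 0 < M := lt_of_lt_of_le (by positivity) hMx
  have hDM : (1 + ε) * D ≤ M * Real.log x := by
    calc (1 + ε) * D ≤ (1 + ε) * (x * s) := by gcongr
      _ = (1 + ε) * (x / Real.log x * s) * Real.log x := by field_simp
      _ ≤ _ := by gcongr
  -- This maximises `exp (-a) * ((1 + a) * (1 - η) * M - (1 + ε / 4) * D)`, with value `exp (-a) *
  -- (1 - η) * M`.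
  set a := (1 + ε / 2) * D / M with ha
  have ha0 : 0 ≤ a := by positivity
  refine ⟨a, ha0, ?_⟩
  have hbad : (D : ℝ) * t / (K * s) ≤ η * M := by
    have h1 : (D : ℝ) * t / (K * s) = η * (D / s) := by rw [hK]; field_simp
    rw [h1]
    gcongr
    rw [div_le_iff₀ hs0]
    have hD0 : (0 : ℝ) ≤ D := Nat.cast_nonneg _
    nlinarith [mul_le_mul_of_nonneg_left hxs hM0.le, mul_nonneg hε.le hD0]
  have haM : a * M = (1 + ε / 2) * D := div_mul_cancel₀ _ hM0.ne'
  have hmain : (1 - η) * M ≤ (1 + a) * (M - D * t / (K * s)) - (t + 1) / t * D := by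
    have h1 : (1 + a) * ((1 - η) * M) ≤ (1 + a) * (M - D * t / (K * s)) := by
      gcongr
      linarith
    have h2 : ((t : ℝ) + 1) / t * D ≤ (1 + ε / 4) * D := by gcongr
    have h3 : (1 + ε / 4) * D = (1 - η) * (a * M) := by rw [haM, ← hη1]; ring
    linarith
  have haβ : a ≤ (1 - β) * Real.log x := by
    have h1 : 1 - β = (1 + ε / 2) / (1 + ε) := by rw [hβ]; field_simp; ring
    rw [ha, h1, div_mul_eq_mul_div, div_le_div_iff₀ hM0 (by linarith)]
    nlinarith
  have hexp : x ^ β / x ≤ Real.exp (-a) := by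
    calc x ^ β / x = Real.exp (-((1 - β) * Real.log x)) := by
          rw [Real.rpow_def_of_pos hx0]
          nth_rewrite 2 [← Real.exp_log hx0]
          rw [← Real.exp_sub]
          congr 1
          ring
      _ ≤ _ := Real.exp_le_exp.2 (by linarith)
  have hl := hlog x hx
  rw [div_mul_eq_mul_div, div_le_iff₀ (by positivity)] at hl
  -- The surplus power `x ^ β`, due to `a` falling short of `log x` by the factor `1 - β`, absorbs
  -- `K * log x` once `x ≥ δ₀`.
  calc K * s = K * Real.log x * (s / Real.log x) := by field_simp
    _ ≤ x ^ β * ((1 - η) * (1 + ε)) * (s / Real.log x) := by gcongr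
    _ = x ^ β / x * ((1 - η) * ((1 + ε) * (x / Real.log x * s))) := by field_simp
    _ ≤ Real.exp (-a) * ((1 - η) * M) := by gcongr
    _ ≤ _ := by gcongr

theorem corollary9p3 :
    ∀ ε : ℝ, 0 < ε →
      ∃ δ₀ : ℝ, 1 < δ₀ ∧ ∃ Δ₀ : ℕ, 2 ≤ Δ₀ ∧
        ∀ Δ : ℕ, Δ₀ ≤ Δ →
          ∀ (V : Type*) [Fintype V] (G : SimpleGraph V) [DecidableRel G.Adj],
            G.CliqueFree 3 → G.maxDegree = Δ →
              ∀ (W : Type*) [Fintype W] (L : V → Finset W) (H : SimpleGraph W),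
                IsCover G L H →
                (∀ u : V,
                  (1 + ε) * max
                    ((G.degree u : ℝ) / Real.log ((G.degree u : ℝ) / Real.log (Δ : ℝ)))
                    (δ₀ / Real.log δ₀ * Real.log (Δ : ℝ)) ≤ ((L u).card : ℝ)) →
                CoverColourable V H := by
  intro ε hε
  obtain ⟨δ₀, hδ₀, Δ₀, hΔ₀, t, ht, K, hK, h⟩ := exists_list_size_parameters hε
  refine ⟨δ₀, hδ₀, Δ₀, hΔ₀, fun Δ hΔ V _ G _ hG hmax W _ L H hc hsize => ?_⟩
  classical
  obtain ⟨hs, hpar⟩ := h Δ hΔ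
  exact hc.colourable_of_count hG (mul_pos hK hs) ht fun v =>
    hpar (G.degree v) (hmax ▸ G.degree_le_maxDegree v) _ (hsize v)
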